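/- Let $S$ be a left cancellative semigroup with identity $1$ (that is, a monoid in which $sr=st$ implies $r=t$). For $X\subseteq S$ and $s,t\in S$ write $sX=\{sx:x\in X\}$ and $t^{-1}X=\{x\in S: tx\in X\}$. Let $J(S)$ be the set of all right ideals of the form $\bigcap_{j=1}^N t_{j1}^{-1}s_{j1}\cdots t_{jn_j}^{-1}s_{jn_j}S$ with $N,n_j\ge 1$ and $s_{jk},t_{jk}\in S$. Li's full $C^*$-algebra $C^*(S)$ is the universal unital $C^*$-algebra generated by isometries $\{v_s:s\in S\}$ and projections $\{e_X:X\in J(S)\cup\{\varnothing\}\}$ such that, for all $s,t\in S$ and $X,Y\in J(S)\cup\{\varnothing\}$, $$v_{st}=v_sv_t,\qquad v_se_Xv_s^*=e_{sX},\qquad e_S=1,\qquad e_\varnothing=0,\qquad e_{X\cap Y}=e_Xe_Y .$$ Let $I(S)$ be the inverse semigroup of all partially defined bijections of $S$ (under composition where defined, with $f^*$ the inverse function of $f$), let $\lambda_s\in I(S)$ be the bijection $S\to sS$, $t\mapsto st$, and let $I_l(S)$ be the inverse subsemigroup of $I(S)$ generated by $\{\lambda_s:s\in S\}$. Write $0$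 for the empty function and let $I_l(S)^0=I_l(S)\cup\{0\}$ (which is $I_l(S)$ itself if $0\in I_l(S)$). For an inverse semigroup $P$, let $C^*(P)$ be its full $C^*$-algebra, i.e. the enveloping $C^*$-algebra of the convolution algebra $\ell^1(P)$, equivalently the completion of $\mathbb{C}P$ in its largest $C^*$-seminorm; if $P$ has a zero $0$, let $C^*_0(P)=C^*(P)/\mathbb{C}0$. Let $C^*_0(I_l(S))$ denote $C^*_0(I_l(S)^0)$, and denote the image of $\lambda_s$ in it again by $\lambda_s$. Then there is a surjective $*$-homomorphism $\eta:C^*(S)\to C^*_0(I_l(S))$ such that $\eta(v_s)=\lambda_s$ for every $s\in S$. If moreover $S$ satisfies Clifford's condition, i.e. for all $s,t\in S$ either $sS\cap tS=\varnothing$ or $sS\cap tS=rS$ for some $r\in S$, then $\eta$ is an isomorphism. -/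

import Mathlib

noncomputable section

namespace SemigroupCStar

/-! ### Universal (enveloping) C*-algebras -/

/-- A C*-seminorm on a unital complex *-algebra. -/
structure CStarSeminorm (A : Type*) [Ring A] [StarRing A] [Algebra ℂ A] extends
    Seminorm ℂ A where
  mul_le' : ∀ a b : A, toFun (a * b) ≤ toFun a * toFun b
  star_mul_self' : ∀ a : A, toFun (star a * a) = toFun a ^ 2

section Envelope

variable {A : Type*} [Ring A] [StarRing A] [Algebra ℂ A]

/-- The C*-seminorms `p` on `A` that respect the relations `a = b` listed by `R`. -/
def Admissible (R : A → A → Prop) : Type _ :=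
  {p : CStarSeminorm A // ∀ a b, R a b → p.toSeminorm (a - b) = 0}

/-- The underlying seminorm. -/
def Admissible.seminorm {R : A → A → Prop} (p : Admissible R) : Seminorm ℂ A :=
  p.1.toSeminorm

theorem Admissible.mul_le {R : A → A → Prop} (p : Admissible R) (a b : A) :
    p.seminorm (a * b) ≤ p.seminorm a * p.seminorm b := p.1.mul_le' a b

theorem Admissible.star_mul_self {R : A → A → Prop} (p : Admissible R) (a : A) :
    p.seminorm (star a * a) = p.seminorm a ^ 2 := p.1.star_mul_self' a

theorem Admissible.rel {R : A → A → Prop} (p : Admissible R) {a b : A} (h : R a b) :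
    p.seminorm (a - b) = 0 := p.2 a b h

theorem Admissible.congr {R : A → A → Prop} (p : Admissible R) {a b : A} (h : R a b) :
    p.seminorm a = p.seminorm b := by
  have h1 := p.rel h
  have h2 := abs_sub_map_le_sub p.seminorm a b
  rw [h1] at h2
  exact sub_eq_zero.mp (abs_nonpos_iff.mp h2)

theorem Admissible.one_le {R : A → A → Prop} (p : Admissible R) : p.seminorm 1 ≤ 1 := by
  have h := p.star_mul_self 1
  rw [star_one, one_mul] at h
  nlinarith [apply_nonneg p.seminorm (1 : A)]

theorem Admissible.le_star {R : A → A → Prop} (p : Admissible R) (a : A) :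
    p.seminorm a ≤ p.seminorm (star a) := by
  have h := p.star_mul_self a
  have h1 := p.mul_le (star a) a
  have h2 := apply_nonneg p.seminorm a
  rcases h2.eq_or_lt with h0 | h0
  · rw [← h0]; exact apply_nonneg _ _
  · nlinarith

theorem Admissible.map_star {R : A → A → Prop} (p : Admissible R) (a : A) :
    p.seminorm (star a) = p.seminorm a :=
  le_antisymm (by simpa using p.le_star (star a)) (p.le_star a)

instance (R : A → A → Prop) : Nonempty (Admissible R) :=
  ⟨⟨{ (0 : Seminorm ℂ A) with
      mul_le' := by intro a b; change (0 : ℝ) ≤ 0 * 0; simp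
      star_mul_self' := by intro a; change (0 : ℝ) = 0 ^ 2; simp }, fun _ _ _ => rfl⟩⟩

/-- The relations `R` bound every element of `A`, so that the universal C*-algebra exists. -/
class HasUniversalCStar (R : A → A → Prop) : Prop where
  bdd : ∀ a : A, BddAbove (Set.range fun p : Admissible R => p.seminorm a)

/-- The largest C*-seminorm on `A` respecting the relations `R`. -/
def maxNorm (R : A → A → Prop) (a : A) : ℝ := ⨆ p : Admissible R, p.seminorm a

section

variable (R : A → A → Prop)

theorem maxNorm_nonneg (a : A) : 0 ≤ maxNorm R a :=
  Real.iSup_nonneg fun p => apply_nonneg p.seminorm a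

theorem maxNorm_zero : maxNorm R (0 : A) = 0 := by simp [maxNorm]

theorem maxNorm_neg (a : A) : maxNorm R (-a) = maxNorm R a := by simp [maxNorm, map_neg_eq_map]

theorem maxNorm_star (a : A) : maxNorm R (star a) = maxNorm R a := by
  simp [maxNorm, Admissible.map_star]

variable [HasUniversalCStar R]

theorem le_maxNorm (p : Admissible R) (a : A) : p.seminorm a ≤ maxNorm R a :=
  le_ciSup (HasUniversalCStar.bdd a) p

theorem maxNorm_add (a b : A) : maxNorm R (a + b) ≤ maxNorm R a + maxNorm R b :=
  ciSup_le fun p => (map_add_le_add p.seminorm a b).trans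
    (add_le_add (le_maxNorm R p a) (le_maxNorm R p b))

theorem maxNorm_mul (a b : A) : maxNorm R (a * b) ≤ maxNorm R a * maxNorm R b :=
  ciSup_le fun p => (p.mul_le a b).trans
    (mul_le_mul (le_maxNorm R p a) (le_maxNorm R p b) (apply_nonneg _ _) (maxNorm_nonneg R a))

theorem maxNorm_smul (c : ℂ) (a : A) : maxNorm R (c • a) ≤ ‖c‖ * maxNorm R a :=
  ciSup_le fun p => by
    rw [map_smul_eq_mul]
    exact mul_le_mul_of_nonneg_left (le_maxNorm R p a) (norm_nonneg c)

theorem maxNorm_mul_self_le (a : A) : maxNorm R a * maxNorm R a ≤ maxNorm R (star a * a) := by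
  have h : maxNorm R a ≤ √(maxNorm R (star a * a)) := ciSup_le fun p => by
    apply Real.le_sqrt_of_sq_le
    rw [← p.star_mul_self]
    exact le_maxNorm R p _
  have := Real.mul_self_sqrt (maxNorm_nonneg R (star a * a))
  nlinarith [maxNorm_nonneg R a]

end

/-- A copy of `A`, carrying the largest C*-seminorm that respects `R`. -/
def PreUniversal (_R : A → A → Prop) : Type _ := A

section

variable (R : A → A → Prop)

instance : Ring (PreUniversal R) := inferInstanceAs (Ring A)
instance : StarRing (PreUniversal R) := inferInstanceAs (StarRing A)
instance : Algebra ℂ (PreUniversal R) := inferInstanceAs (Algebra ℂ A)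
instance [StarModule ℂ A] : StarModule ℂ (PreUniversal R) := inferInstanceAs (StarModule ℂ A)

variable [HasUniversalCStar R]

instance : SeminormedRing (PreUniversal R) where
  __ := (inferInstance : Ring (PreUniversal R))
  __ := AddGroupSeminorm.toSeminormedAddCommGroup
    (E := PreUniversal R)
    { toFun := maxNorm R
      map_zero' := maxNorm_zero R
      add_le' := maxNorm_add R
      neg' := maxNorm_neg R }
  norm_mul_le := maxNorm_mul R

instance : NormedAlgebra ℂ (PreUniversal R) where
  norm_smul_le := maxNorm_smul R

theorem PreUniversal.norm_def (a : PreUniversal R) : ‖a‖ = maxNorm R a := rfl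

instance : NormedStarGroup (PreUniversal R) where
  norm_star_le a := (maxNorm_star R a).le

/-- The universal C*-algebra of the *-algebra `A` subject to the relations `R`: the Hausdorff
completion of `A` with respect to the largest C*-seminorm respecting `R`. -/
abbrev UniversalCStar : Type _ := UniformSpace.Completion (PreUniversal R)

open UniformSpace UniformSpace.Completion

instance : Star (UniversalCStar R) :=
  ⟨Completion.map (star : PreUniversal R → PreUniversal R)⟩

theorem UniversalCStar.uniformContinuous_star :
    UniformContinuous (star : PreUniversal R → PreUniversal R) :=
  AddMonoidHomClass.uniformContinuous_of_bound (starAddEquiv : PreUniversal R ≃+ PreUniversal R) 1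
    fun a => by simp

theorem UniversalCStar.coe_star (a : PreUniversal R) :
    ((star a : PreUniversal R) : UniversalCStar R) = star (a : UniversalCStar R) :=
  (Completion.map_coe (UniversalCStar.uniformContinuous_star R) a).symm

theorem UniversalCStar.continuous_star :
    Continuous (star : UniversalCStar R → UniversalCStar R) :=
  Completion.continuous_map

instance : StarRing (UniversalCStar R) where
  star_involutive x := by
    induction x using Completion.induction_on with
    | hp =>
      exact isClosed_eq ((UniversalCStar.continuous_star R).comp
        (UniversalCStar.continuous_star R)) continuous_id
    | ih a => rw [← UniversalCStar.coe_star, ← UniversalCStar.coe_star, star_star]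
  star_mul x y := by
    induction x, y using Completion.induction_on₂ with
    | hp =>
      have := UniversalCStar.continuous_star R
      exact isClosed_eq (by fun_prop) (by fun_prop)
    | ih a b =>
      rw [← Completion.coe_mul, ← UniversalCStar.coe_star, ← UniversalCStar.coe_star,
        ← UniversalCStar.coe_star, star_mul, Completion.coe_mul]
  star_add x y := by
    induction x, y using Completion.induction_on₂ with
    | hp =>
      have := UniversalCStar.continuous_star R
      exact isClosed_eq (by fun_prop) (by fun_prop)
    | ih a b =>
      rw [← Completion.coe_add, ← UniversalCStar.coe_star, ← UniversalCStar.coe_star,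
        ← UniversalCStar.coe_star, star_add, Completion.coe_add]

instance : CStarRing (UniversalCStar R) where
  norm_mul_self_le x := by
    induction x using Completion.induction_on with
    | hp =>
      have := UniversalCStar.continuous_star R
      exact isClosed_le (by fun_prop) (by fun_prop)
    | ih a =>
      rw [← UniversalCStar.coe_star, ← Completion.coe_mul, Completion.norm_coe,
        Completion.norm_coe]
      exact maxNorm_mul_self_le R a

variable [StarModule ℂ A]

instance : StarModule ℂ (UniversalCStar R) where
  star_smul c x := by
    have h : star (algebraMap ℂ (UniversalCStar R) c) = algebraMap ℂ (UniversalCStar R) (star c) := by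
      rw [Completion.algebraMap_def, Completion.algebraMap_def, ← UniversalCStar.coe_star,
        algebraMap_star_comm]
    rw [Algebra.smul_def, Algebra.smul_def, star_mul, h]
    exact (Algebra.commutes _ _).symm

instance : NormedAlgebra ℂ (UniversalCStar R) where
  norm_smul_le := norm_smul_le

instance : CStarAlgebra (UniversalCStar R) where

/-- The canonical *-homomorphism from `A` into its universal C*-algebra. -/
def toUniversal : A →⋆ₐ[ℂ] UniversalCStar R where
  toFun a := ((show PreUniversal R from a) : UniversalCStar R)
  map_one' := Completion.coe_one _
  map_mul' a b := Completion.coe_mul (α := PreUniversal R) a b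
  map_zero' := Completion.coe_zero
  map_add' a b := Completion.coe_add (α := PreUniversal R) a b
  commutes' _ := rfl
  map_star' a := UniversalCStar.coe_star R a

end

end Envelope

/-! ### The *-algebra of a monoid with involution -/

section MonoidStar

variable {M : Type*} [Monoid M] [StarMul M]

/-- The involution `(∑ aᵢ mᵢ)* = ∑ conj(aᵢ) mᵢ*` on `ℂM`. -/
instance : Star (MonoidAlgebra ℂ M) :=
  ⟨fun x => x.coeff.sum fun m c => MonoidAlgebra.single (star m) (star c)⟩

theorem star_single (m : M) (c : ℂ) :
    star (MonoidAlgebra.single m c) = MonoidAlgebra.single (star m) (star c) := by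
  change Finsupp.sum _ _ = _
  rw [MonoidAlgebra.coeff_single, Finsupp.sum_single_index (by simp)]

theorem star_add_aux (x y : MonoidAlgebra ℂ M) : star (x + y) = star x + star y := by
  change Finsupp.sum _ _ = Finsupp.sum _ _ + Finsupp.sum _ _
  rw [MonoidAlgebra.coeff_add, Finsupp.sum_add_index']
  · simp
  · intro m c d
    rw [star_add, MonoidAlgebra.single_add]

instance : StarRing (MonoidAlgebra ℂ M) where
  star_involutive x := by
    induction x using MonoidAlgebra.induction_linear with
    | zero => exact (congrArg star (Finsupp.sum_zero_index)).trans Finsupp.sum_zero_index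
    | add x y hx hy => rw [star_add_aux, star_add_aux, hx, hy]
    | single m c => rw [star_single, star_single, star_star, star_star]
  star_add := star_add_aux
  star_mul x y := by
    have h0 : star (0 : MonoidAlgebra ℂ M) = 0 := Finsupp.sum_zero_index
    induction x using MonoidAlgebra.induction_linear with
    | zero => rw [zero_mul, h0, mul_zero]
    | add x x' hx hx' => rw [add_mul, star_add_aux, star_add_aux, hx, hx', mul_add]
    | single m c =>
      induction y using MonoidAlgebra.induction_linear with
      | zero => rw [mul_zero, h0, zero_mul]
      | add y y' hy hy' => rw [mul_add, star_add_aux, star_add_aux, hy, hy', add_mul]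
      | single n d =>
        rw [MonoidAlgebra.single_mul_single, star_single, star_single, star_single,
          MonoidAlgebra.single_mul_single, star_mul, star_mul]

instance : StarModule ℂ (MonoidAlgebra ℂ M) where
  star_smul c x := by
    induction x using MonoidAlgebra.induction_linear with
    | zero => simp
    | add x y hx hy => rw [smul_add, star_add, hx, hy, star_add, smul_add]
    | single m d =>
      rw [MonoidAlgebra.smul_single, star_single, star_single, MonoidAlgebra.smul_single,
        smul_eq_mul, smul_eq_mul, star_mul']

theorem hasUniversalCStar_of_le_one {R : MonoidAlgebra ℂ M → MonoidAlgebra ℂ M → Prop}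
    (h : ∀ (p : Admissible R) (m : M), p.seminorm (MonoidAlgebra.of ℂ M m) ≤ 1) :
    HasUniversalCStar R where
  bdd x := by
    induction x using MonoidAlgebra.induction_on with
    | of m => exact ⟨1, by rintro _ ⟨p, rfl⟩; exact h p m⟩
    | add x y hx hy =>
      obtain ⟨a, ha⟩ := hx
      obtain ⟨b, hb⟩ := hy
      refine ⟨a + b, ?_⟩
      rintro _ ⟨p, rfl⟩
      exact (map_add_le_add p.seminorm x y).trans (add_le_add (ha ⟨p, rfl⟩) (hb ⟨p, rfl⟩))
    | smul c x hx =>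
      obtain ⟨a, ha⟩ := hx
      refine ⟨‖c‖ * a, ?_⟩
      rintro _ ⟨p, rfl⟩
      change p.seminorm (c • x) ≤ _
      rw [map_smul_eq_mul]
      exact mul_le_mul_of_nonneg_left (ha ⟨p, rfl⟩) (norm_nonneg c)

end MonoidStar

/-! ### The C*-algebras `C*(P)` and `C*₀(P)` of an inverse semigroup -/

/-- Inverse semigroups (with identity), with `star p` as the notation for the inverse `p*`:
`p*` is the unique element `q` with `p q p = p` and `q p q = q`. -/
class IsInverseSemigroup (P : Type*) [Monoid P] [StarMul P] : Prop where
  mul_star_mul : ∀ p : P, p * star p * p = p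
  eq_star : ∀ p q : P, p * q * p = p → q * p * q = q → q = star p

section InverseSemigroup

variable (P : Type*)

/-- No relation at all on `ℂP`. -/
def noRel (A : Type*) : A → A → Prop := fun _ _ => False

instance [Monoid P] [StarMul P] [IsInverseSemigroup P] :
    HasUniversalCStar (noRel (MonoidAlgebra ℂ P)) :=
  hasUniversalCStar_of_le_one fun p m => by
    have h1 := p.star_mul_self (MonoidAlgebra.of ℂ P m)
    have h2 := p.star_mul_self (star (MonoidAlgebra.of ℂ P m) * MonoidAlgebra.of ℂ P m)
    have h3 : star (star (MonoidAlgebra.of ℂ P m) * MonoidAlgebra.of ℂ P m) *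
        (star (MonoidAlgebra.of ℂ P m) * MonoidAlgebra.of ℂ P m) =
        star (MonoidAlgebra.of ℂ P m) * MonoidAlgebra.of ℂ P m := by
      have : star (MonoidAlgebra.of ℂ P m) = MonoidAlgebra.of ℂ P (star m) := by
        simp [MonoidAlgebra.of_apply, star_single]
      rw [star_mul, star_star, this, ← map_mul, ← map_mul, mul_assoc, ← mul_assoc m,
        IsInverseSemigroup.mul_star_mul]
    rw [h3] at h2
    have h4 := apply_nonneg p.seminorm (MonoidAlgebra.of ℂ P m)
    by_contra hlt
    push Not at hlt
    rw [h1] at h2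
    nlinarith [mul_self_nonneg (p.seminorm (MonoidAlgebra.of ℂ P m) - 1)]

/-- The full C*-algebra `C*(P)` of the inverse semigroup `P`: the completion of `ℂP` with respect
to its largest C*-seminorm. Every C*-seminorm on `ℂP` is at most `1` on each `p ∈ P`, hence
dominated by the `ℓ¹`-norm, so this is the enveloping C*-algebra of `ℓ¹(P)`. -/
abbrev FullCStar [Monoid P] [StarMul P] [IsInverseSemigroup P] : Type _ :=
  UniversalCStar (noRel (MonoidAlgebra ℂ P))

variable {P}

/-- The canonical image of `p ∈ P` in `C*(P)`. -/
def FullCStar.of [Monoid P] [StarMul P] [IsInverseSemigroup P] (p : P) : FullCStar P :=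
  toUniversal _ (MonoidAlgebra.of ℂ P p)

variable [MonoidWithZero P] [StarMul P] [IsInverseSemigroup P]

theorem star_zero_eq : star (0 : P) = 0 := by
  have h := IsInverseSemigroup.eq_star (0 : P) 0 (by simp) (by simp)
  exact h.symm

theorem isClosed_span_zero :
    IsClosed ((Submodule.span ℂ {FullCStar.of (0 : P)} : Submodule ℂ (FullCStar P)) :
      Set (FullCStar P)) :=
  Submodule.closed_of_finiteDimensional _

theorem toUniversal_single (p : P) (c : ℂ) :
    toUniversal (noRel (MonoidAlgebra ℂ P)) (MonoidAlgebra.single p c) =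
      c • FullCStar.of p := by
  rw [FullCStar.of, ← map_smul, MonoidAlgebra.of_apply, MonoidAlgebra.smul_single, smul_eq_mul,
    mul_one]

theorem FullCStar.of_mul (p q : P) : FullCStar.of (p * q) = FullCStar.of p * FullCStar.of q := by
  rw [FullCStar.of, map_mul, map_mul]; rfl

theorem FullCStar.star_of (p : P) : star (FullCStar.of p) = FullCStar.of (star p) := by
  rw [FullCStar.of, FullCStar.of, ← map_star]
  simp [MonoidAlgebra.of_apply, star_single]

theorem FullCStar.induction {motive : FullCStar P → Prop} (a : FullCStar P)
    (hc : IsClosed {a | motive a}) (h0 : motive 0)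
    (hadd : ∀ a b, motive a → motive b → motive (a + b))
    (hof : ∀ (c : ℂ) (p : P), motive (c • FullCStar.of p)) : motive a := by
  have key : ∀ x : MonoidAlgebra ℂ P, motive (toUniversal (noRel (MonoidAlgebra ℂ P)) x) := by
    intro x
    induction x using MonoidAlgebra.induction_linear with
    | zero => rw [map_zero]; exact h0
    | add x y hx hy => rw [map_add]; exact hadd _ _ hx hy
    | single p c => rw [toUniversal_single]; exact hof c p
  induction a using UniformSpace.Completion.induction_on with
  | hp => exact hc
  | ih x => exact key x

theorem FullCStar.mul_zero_mem (a : FullCStar P) :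
    a * FullCStar.of (0 : P) ∈ Submodule.span ℂ {FullCStar.of (0 : P)} := by
  induction a using FullCStar.induction with
  | hc => exact isClosed_span_zero.preimage (continuous_mul_const (FullCStar.of (0 : P)))
  | h0 => rw [zero_mul]; exact Submodule.zero_mem _
  | hadd a b ha hb => rw [add_mul]; exact Submodule.add_mem _ ha hb
  | hof c p =>
    rw [smul_mul_assoc, ← FullCStar.of_mul, mul_zero]
    exact Submodule.smul_mem _ _ (Submodule.mem_span_singleton_self _)

theorem FullCStar.zero_mul_mem (a : FullCStar P) :
    FullCStar.of (0 : P) * a ∈ Submodule.span ℂ {FullCStar.of (0 : P)} := by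
  induction a using FullCStar.induction with
  | hc => exact isClosed_span_zero.preimage (continuous_const_mul (FullCStar.of (0 : P)))
  | h0 => rw [mul_zero]; exact Submodule.zero_mem _
  | hadd a b ha hb => rw [mul_add]; exact Submodule.add_mem _ ha hb
  | hof c p =>
    rw [mul_smul_comm, ← FullCStar.of_mul, zero_mul]
    exact Submodule.smul_mem _ _ (Submodule.mem_span_singleton_self _)

variable (P) in
/-- The ideal `ℂ0` of `C*(P)` spanned by the zero element of `P`. -/
def zeroIdeal : Ideal (FullCStar P) where
  carrier := (Submodule.span ℂ {FullCStar.of (0 : P)} : Submodule ℂ (FullCStar P))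
  add_mem' := Submodule.add_mem _
  zero_mem' := Submodule.zero_mem _
  smul_mem' a x hx := by
    obtain ⟨c, rfl⟩ := Submodule.mem_span_singleton.mp hx
    rw [smul_eq_mul, mul_smul_comm]
    exact Submodule.smul_mem _ _ (FullCStar.mul_zero_mem a)

theorem mem_zeroIdeal {x : FullCStar P} :
    x ∈ zeroIdeal P ↔ ∃ c : ℂ, c • FullCStar.of (0 : P) = x :=
  Submodule.mem_span_singleton

instance : (zeroIdeal P).IsTwoSided where
  mul_mem_of_left b hx := by
    obtain ⟨c, rfl⟩ := mem_zeroIdeal.mp hx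
    rw [smul_mul_assoc]
    exact Submodule.smul_mem (Submodule.span ℂ {FullCStar.of (0 : P)}) _
      (FullCStar.zero_mul_mem b)

instance : IsClosed (zeroIdeal P : Set (FullCStar P)) := isClosed_span_zero

theorem star_mem_zeroIdeal {x : FullCStar P} (hx : x ∈ zeroIdeal P) : star x ∈ zeroIdeal P := by
  obtain ⟨c, rfl⟩ := mem_zeroIdeal.mp hx
  rw [star_smul, FullCStar.star_of, star_zero_eq]
  exact mem_zeroIdeal.mpr ⟨_, rfl⟩

variable (P) in
/-- The C*-algebra `C*₀(P) = C*(P) / ℂ0` of an inverse semigroup with zero, with its quotient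
norm. -/
def FullCStarZero : Type _ := FullCStar P ⧸ zeroIdeal P

namespace FullCStarZero

instance : Ring (FullCStarZero P) := inferInstanceAs (Ring (FullCStar P ⧸ zeroIdeal P))
instance : Algebra ℂ (FullCStarZero P) :=
  inferInstanceAs (Algebra ℂ (FullCStar P ⧸ zeroIdeal P))

/-- The quotient map `C*(P) → C*₀(P)`. -/
def mk : FullCStar P →ₐ[ℂ] FullCStarZero P := Ideal.Quotient.mkₐ ℂ (zeroIdeal P)

theorem mk_surjective : Function.Surjective (mk : FullCStar P → FullCStarZero P) :=
  Ideal.Quotient.mk_surjective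

theorem mk_eq_mk {a b : FullCStar P} : mk a = mk b ↔ a - b ∈ zeroIdeal P :=
  Ideal.Quotient.mk_eq_mk_iff_sub_mem a b

instance : Star (FullCStarZero P) where
  star := Quotient.lift (fun a : FullCStar P => mk (star a)) fun a b h => by
    have h' : a - b ∈ zeroIdeal P := (Submodule.quotientRel_def _).mp h
    rw [mk_eq_mk, ← star_sub]
    exact star_mem_zeroIdeal h'

theorem star_mk (a : FullCStar P) : star (mk a) = mk (star a) := rfl

instance : StarRing (FullCStarZero P) where
  star_involutive x := by
    obtain ⟨a, rfl⟩ := mk_surjective x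
    rw [star_mk, star_mk, star_star]
  star_mul x y := by
    obtain ⟨a, rfl⟩ := mk_surjective x
    obtain ⟨b, rfl⟩ := mk_surjective y
    rw [← map_mul, star_mk, star_mk, star_mk, star_mul, map_mul]
  star_add x y := by
    obtain ⟨a, rfl⟩ := mk_surjective x
    obtain ⟨b, rfl⟩ := mk_surjective y
    rw [← map_add, star_mk, star_mk, star_mk, star_add, map_add]

instance : StarModule ℂ (FullCStarZero P) where
  star_smul c x := by
    obtain ⟨a, rfl⟩ := mk_surjective x
    rw [← map_smul, star_mk, star_mk, star_smul, map_smul]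

instance : NormedAddCommGroup (FullCStarZero P) :=
  inferInstanceAs (NormedAddCommGroup (FullCStar P ⧸ zeroIdeal P))

instance : CompleteSpace (FullCStarZero P) :=
  inferInstanceAs (CompleteSpace (FullCStar P ⧸ zeroIdeal P))

theorem norm_mk_le (a : FullCStar P) : ‖(mk a : FullCStarZero P)‖ ≤ ‖a‖ :=
  Submodule.Quotient.norm_mk_le (S := zeroIdeal P) a

theorem exists_norm_lt (x : FullCStarZero P) {ε : ℝ} (hε : 0 < ε) :
    ∃ a : FullCStar P, mk a = x ∧ ‖a‖ < ‖x‖ + ε :=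
  Submodule.Quotient.norm_mk_lt (S := zeroIdeal P) x hε

theorem norm_mul_le (x y : FullCStarZero P) : ‖x * y‖ ≤ ‖x‖ * ‖y‖ := by
  have h : ∀ ε > 0, ‖x * y‖ ≤ (‖x‖ + ε) * (‖y‖ + ε) := by
    intro ε hε
    obtain ⟨a, rfl, ha⟩ := exists_norm_lt x hε
    obtain ⟨b, rfl, hb⟩ := exists_norm_lt y hε
    rw [← map_mul]
    exact (norm_mk_le _).trans ((_root_.norm_mul_le a b).trans
      (mul_le_mul ha.le hb.le (norm_nonneg _) (by positivity)))
  have ht : Filter.Tendsto (fun ε : ℝ => (‖x‖ + ε) * (‖y‖ + ε)) (nhdsWithin 0 (Set.Ioi 0))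
      (nhds (‖x‖ * ‖y‖)) := by
    have : Continuous fun ε : ℝ => (‖x‖ + ε) * (‖y‖ + ε) := by fun_prop
    simpa using (this.tendsto 0).mono_left nhdsWithin_le_nhds
  exact ge_of_tendsto ht (eventually_nhdsWithin_of_forall h)

instance : NormedRing (FullCStarZero P) where
  __ := (inferInstance : Ring (FullCStarZero P))
  __ := (inferInstance : NormedAddCommGroup (FullCStarZero P))
  norm_mul_le := norm_mul_le

instance : NormedAlgebra ℂ (FullCStarZero P) where
  norm_smul_le c x := by
    have h : ∀ ε > 0, ‖c • x‖ ≤ ‖c‖ * (‖x‖ + ε) := by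
      intro ε hε
      obtain ⟨a, rfl, ha⟩ := exists_norm_lt x hε
      rw [← map_smul]
      exact (norm_mk_le _).trans ((norm_smul_le c a).trans
        (mul_le_mul_of_nonneg_left ha.le (norm_nonneg _)))
    have ht : Filter.Tendsto (fun ε : ℝ => ‖c‖ * (‖x‖ + ε)) (nhdsWithin 0 (Set.Ioi 0))
        (nhds (‖c‖ * ‖x‖)) := by
      have : Continuous fun ε : ℝ => ‖c‖ * (‖x‖ + ε) := by fun_prop
      simpa using (this.tendsto 0).mono_left nhdsWithin_le_nhds
    exact ge_of_tendsto ht (eventually_nhdsWithin_of_forall h)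

/-- The quotient norm of `a` is the norm of `a (1 - 0_P)`, since `0_P` is a central projection. -/
theorem norm_mk (a : FullCStar P) :
    ‖(mk a : FullCStarZero P)‖ = ‖a * (1 - FullCStar.of (0 : P))‖ := by
  have hz : FullCStar.of (0 : P) * FullCStar.of (0 : P) = FullCStar.of (0 : P) := by
    rw [← FullCStar.of_mul, mul_zero]
  have hs : star (FullCStar.of (0 : P)) = FullCStar.of (0 : P) := by
    rw [FullCStar.star_of, star_zero_eq]
  have hn : ‖(1 - FullCStar.of (0 : P) : FullCStar P)‖ ≤ 1 := by
    have h := CStarRing.norm_star_mul_self (x := (1 - FullCStar.of (0 : P) : FullCStar P))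
    have h2 : star (1 - FullCStar.of (0 : P)) * (1 - FullCStar.of (0 : P)) =
        1 - FullCStar.of (0 : P) := by
      rw [star_sub, star_one, hs, mul_sub, sub_mul, sub_mul, hz]
      simp
    rw [h2] at h
    nlinarith [norm_nonneg (1 - FullCStar.of (0 : P) : FullCStar P)]
  apply le_antisymm
  · have : (mk a : FullCStarZero P) = mk (a * (1 - FullCStar.of (0 : P))) := by
      rw [mk_eq_mk, mul_sub, mul_one, sub_sub_cancel]
      exact FullCStar.mul_zero_mem a
    rw [this]
    exact norm_mk_le _
  · apply le_of_forall_pos_le_add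
    intro ε hε
    obtain ⟨b, hb, hlt⟩ := exists_norm_lt (mk a) hε
    obtain ⟨c, hc⟩ := mem_zeroIdeal.mp (mk_eq_mk.mp hb)
    have h1 : a * (1 - FullCStar.of (0 : P)) = b * (1 - FullCStar.of (0 : P)) := by
      rw [← sub_eq_zero, ← sub_mul, ← neg_sub b a, ← hc, mul_sub, mul_one, neg_mul,
        smul_mul_assoc, hz, sub_self]
    rw [h1]
    exact ((_root_.norm_mul_le _ _).trans (mul_le_of_le_one_right (norm_nonneg _) hn)).trans hlt.le

theorem zero_comm (a : FullCStar P) :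
    FullCStar.of (0 : P) * a = a * FullCStar.of (0 : P) := by
  have hz : FullCStar.of (0 : P) * FullCStar.of (0 : P) = FullCStar.of (0 : P) := by
    rw [← FullCStar.of_mul, mul_zero]
  obtain ⟨c, hc⟩ := Submodule.mem_span_singleton.mp (FullCStar.mul_zero_mem a)
  obtain ⟨d, hd⟩ := Submodule.mem_span_singleton.mp (FullCStar.zero_mul_mem a)
  have h1 : FullCStar.of (0 : P) * a * FullCStar.of (0 : P) = d • FullCStar.of (0 : P) := by
    rw [← hd, smul_mul_assoc, hz]
  have h2 : FullCStar.of (0 : P) * a * FullCStar.of (0 : P) = c • FullCStar.of (0 : P) := by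
    rw [mul_assoc, ← hc, mul_smul_comm, hz]
  rw [← hc, ← hd, ← h1, ← h2]

instance : CStarRing (FullCStarZero P) where
  norm_mul_self_le x := by
    obtain ⟨a, rfl⟩ := mk_surjective x
    have hz : FullCStar.of (0 : P) * FullCStar.of (0 : P) = FullCStar.of (0 : P) := by
      rw [← FullCStar.of_mul, mul_zero]
    have hs : star (FullCStar.of (0 : P)) = FullCStar.of (0 : P) := by
      rw [FullCStar.star_of, star_zero_eq]
    have h : star (a * (1 - FullCStar.of (0 : P))) * (a * (1 - FullCStar.of (0 : P))) =
        star a * a * (1 - FullCStar.of (0 : P)) := by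
      have e : (1 - FullCStar.of (0 : P)) * (star a * a) =
          star a * a * (1 - FullCStar.of (0 : P)) := by
        rw [sub_mul, mul_sub, zero_comm, one_mul, mul_one]
      have e2 : (1 - FullCStar.of (0 : P)) * (1 - FullCStar.of (0 : P)) =
          1 - FullCStar.of (0 : P) := by
        rw [mul_sub, sub_mul, sub_mul, hz]; simp
      rw [star_mul, star_sub, star_one, hs, mul_assoc, ← mul_assoc (star a), ← mul_assoc, e,
        mul_assoc, e2]
    rw [star_mk, ← map_mul, norm_mk, norm_mk, ← h, CStarRing.norm_star_mul_self]

instance : CStarAlgebra (FullCStarZero P) where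

/-- The canonical image of `p ∈ P` in `C*₀(P)`. -/
def of (p : P) : FullCStarZero P := mk (FullCStar.of p)

end FullCStarZero

end InverseSemigroup

/-! ### The left inverse hull -/

/-- The semigroup `I(X)` of partially defined bijections of `X`. -/
def PartialBij (X : Type*) : Type _ := X ≃. X

namespace PartialBij

variable {X : Type*}

/-- `f * g` is "first `g`, then `f`"; `0` is the empty function. -/
instance : MonoidWithZero (PartialBij X) where
  mul f g := PEquiv.trans g f
  mul_assoc f g h := (PEquiv.trans_assoc h g f).symm
  one := PEquiv.refl X
  one_mul f := PEquiv.trans_refl f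
  mul_one f := PEquiv.refl_trans f
  zero := (⊥ : X ≃. X)
  zero_mul f := PEquiv.trans_bot f
  mul_zero f := PEquiv.bot_trans f

/-- The involution is function inversion. -/
instance : StarMul (PartialBij X) where
  star f := PEquiv.symm f
  star_involutive f := PEquiv.symm_symm f
  star_mul f g := PEquiv.symm_trans_rev g f

/-- The graph of a partial bijection: `x ∈ dom f` and `f x = y`. -/
def Maps (f : PartialBij X) (x y : X) : Prop := PEquiv.toFun f x = some y

theorem maps_mul {f g : PartialBij X} {x z : X} :
    Maps (f * g) x z ↔ ∃ y, Maps g x y ∧ Maps f y z :=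
  PEquiv.mem_trans g f x z

theorem maps_star {f : PartialBij X} {x y : X} : Maps (star f) x y ↔ Maps f y x :=
  PEquiv.mem_iff_mem f

theorem ext_maps {f g : PartialBij X} (h : ∀ x y, Maps f x y ↔ Maps g x y) : f = g :=
  PEquiv.ext fun x => Option.ext fun y => h x y

theorem Maps.inj {f : PartialBij X} {x x' y : X} (h : Maps f x y) (h' : Maps f x' y) : x = x' :=
  PEquiv.inj f h h'

theorem Maps.unique {f : PartialBij X} {x y y' : X} (h : Maps f x y) (h' : Maps f x y') : y = y' :=
  Option.mem_unique h h'

theorem mul_star_mul (f : PartialBij X) : f * star f * f = f := by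
  apply ext_maps
  intro x y
  simp only [maps_mul, maps_star]
  constructor
  · rintro ⟨a, ha, b, hb, hc⟩
    rwa [← hb.inj ha]
  · intro h
    exact ⟨y, h, x, h, h⟩

theorem maps_of_mul_mul {f g : PartialBij X} (h : f * g * f = f) {x y : X} (hxy : Maps f x y) :
    Maps g y x := by
  have h' := hxy
  rw [← h] at h'
  simp only [maps_mul] at h'
  obtain ⟨a, ha, b, hb, hc⟩ := h'
  rwa [← hxy.unique ha, hc.inj hxy] at hb

theorem eq_star (f g : PartialBij X) (h1 : f * g * f = f) (h2 : g * f * g = g) : g = star f := by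
  apply ext_maps
  intro y x
  rw [maps_star]
  exact ⟨maps_of_mul_mul h2, maps_of_mul_mul h1⟩

end PartialBij

section Hull

variable (S : Type*) [Monoid S] [IsLeftCancelMul S]

variable {S} in
open Classical in
/-- The partial bijection `λ_s : S → sS`, `t ↦ st`. -/
def lam (s : S) : PartialBij S where
  toFun t := some (s * t)
  invFun t := if h : ∃ r, s * r = t then some h.choose else none
  inv a b := by
    rw [Option.some_inj]
    constructor
    · intro h
      split_ifs at h with h'
      rw [← Option.some.inj h]
      exact h'.choose_spec
    · intro h
      have h' : ∃ r, s * r = b := ⟨a, h⟩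
      rw [dif_pos h', mul_left_cancel (h'.choose_spec.trans h.symm)]

/-- The left inverse hull `I_l(S)`: the inverse subsemigroup of `I(S)` generated by the `λ_s`. -/
def leftInverseHull : Submonoid (PartialBij S) :=
  Submonoid.closure (Set.range (lam : S → PartialBij S) ∪
    Set.range fun s : S => star (lam s : PartialBij S))

/-- `I_l(S)⁰`: the left inverse hull together with the empty function `0`. It equals `I_l(S)` if
the latter contains the empty function already. -/
def leftInverseHull₀ : Submonoid (PartialBij S) where
  carrier := leftInverseHull S ∪ {0}
  one_mem' := Or.inl (one_mem _)
  mul_mem' := by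
    rintro a b (ha | ha) (hb | hb)
    · exact Or.inl (mul_mem ha hb)
    · rw [Set.mem_singleton_iff] at hb; right; simp [hb]
    · rw [Set.mem_singleton_iff] at ha; right; simp [ha]
    · rw [Set.mem_singleton_iff] at ha; right; simp [ha]

theorem star_mem_leftInverseHull {f : PartialBij S} (hf : f ∈ leftInverseHull S) :
    star f ∈ leftInverseHull S := by
  induction hf using Submonoid.closure_induction with
  | mem x hx =>
    apply Submonoid.subset_closure
    rcases hx with ⟨s, rfl⟩ | ⟨s, rfl⟩
    · exact Or.inr ⟨s, rfl⟩
    · exact Or.inl ⟨s, (star_star _).symm⟩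
  | one => rw [star_one]; exact one_mem _
  | mul x y _ _ hx hy => rw [star_mul]; exact mul_mem hy hx

theorem PartialBij.star_zero {X : Type*} : star (0 : PartialBij X) = 0 := rfl

theorem star_mem_leftInverseHull₀ {f : PartialBij S} (hf : f ∈ leftInverseHull₀ S) :
    star f ∈ leftInverseHull₀ S := by
  rcases hf with hf | hf
  · exact Or.inl (star_mem_leftInverseHull S hf)
  · rw [Set.mem_singleton_iff] at hf
    right
    rw [hf, PartialBij.star_zero, Set.mem_singleton_iff]

instance : MonoidWithZero (leftInverseHull₀ S) where
  zero := ⟨0, Or.inr rfl⟩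
  zero_mul a := Subtype.ext (zero_mul a.1)
  mul_zero a := Subtype.ext (mul_zero a.1)

instance : StarMul (leftInverseHull₀ S) where
  star f := ⟨star f.1, star_mem_leftInverseHull₀ S f.2⟩
  star_involutive f := Subtype.ext (star_star f.1)
  star_mul f g := Subtype.ext (star_mul f.1 g.1)

instance : IsInverseSemigroup (leftInverseHull₀ S) where
  mul_star_mul f := Subtype.ext (PartialBij.mul_star_mul f.1)
  eq_star f g h1 h2 := Subtype.ext
    (PartialBij.eq_star f.1 g.1 (congrArg Subtype.val h1) (congrArg Subtype.val h2))

/-- `C*₀(I_l(S))`. If the empty function is not in `I_l(S)`, this is canonically `C*(I_l(S))`. -/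
abbrev HullCStar : Type _ := FullCStarZero (leftInverseHull₀ S)

variable {S} in
/-- The canonical image of `λ_s` in `C*₀(I_l(S))`. -/
def HullCStar.lam (s : S) : HullCStar S :=
  FullCStarZero.of ⟨SemigroupCStar.lam s, Or.inl (Submonoid.subset_closure (Or.inl ⟨s, rfl⟩))⟩

end Hull

/-! ### Constructible right ideals and Li's full C*-algebra -/

section ConstructibleIdeals

variable {S : Type*} [Monoid S]

/-- The right ideal `t₁⁻¹ s₁ ⋯ tₙ⁻¹ sₙ S`, for the list `(t₁, s₁), …, (tₙ, sₙ)`, where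
`sX = {s x | x ∈ X}` and `t⁻¹X = {x | t x ∈ X}`. -/
def wordIdeal : List (S × S) → Set S
  | [] => Set.univ
  | (t, s) :: l => {x | t * x ∈ (fun y => s * y) '' wordIdeal l}

/-- `X ∈ J(S)`: `X` is a nonempty finite intersection of right ideals
`t₁⁻¹ s₁ ⋯ tₙ⁻¹ sₙ S` with `n ≥ 1`. -/
def IsConstructible (X : Set S) : Prop :=
  ∃ F : Finset (List (S × S)), F.Nonempty ∧ (∀ l ∈ F, l ≠ []) ∧ X = ⋂ l ∈ F, wordIdeal l

theorem isConstructible_univ : IsConstructible (Set.univ : Set S) := by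
  refine ⟨{[(1, 1)]}, by simp, by simp, ?_⟩
  simp [wordIdeal]

theorem IsConstructible.inter {X Y : Set S} (hX : IsConstructible X) (hY : IsConstructible Y) :
    IsConstructible (X ∩ Y) := by
  classical
  obtain ⟨F, hF, hF', rfl⟩ := hX
  obtain ⟨G, hG, hG', rfl⟩ := hY
  refine ⟨F ∪ G, hF.mono Finset.subset_union_left, ?_, ?_⟩
  · intro l hl
    rcases Finset.mem_union.mp hl with h | h
    exacts [hF' l h, hG' l h]
  · ext x
    simp only [Set.mem_inter_iff, Set.mem_iInter, Finset.mem_union]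
    exact ⟨fun h l hl => hl.elim (h.1 l) (h.2 l),
      fun h => ⟨fun l hl => h l (Or.inl hl), fun l hl => h l (Or.inr hl)⟩⟩

theorem IsConstructible.image [IsLeftCancelMul S] {X : Set S} (hX : IsConstructible X) (s : S) :
    IsConstructible ((fun y => s * y) '' X) := by
  classical
  obtain ⟨F, ⟨l₀, hl₀⟩, hF', rfl⟩ := hX
  refine ⟨F.image fun l => (1, s) :: l, ⟨_, Finset.mem_image_of_mem _ hl₀⟩, by simp, ?_⟩
  ext x
  simp only [Set.mem_image, Set.mem_iInter, Finset.mem_image, forall_exists_index, and_imp,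
    forall_apply_eq_imp_iff₂, wordIdeal, one_mul, Set.mem_ofPred_eq]
  constructor
  · rintro ⟨y, hy, rfl⟩ l hl
    exact ⟨y, hy l hl, rfl⟩
  · intro h
    obtain ⟨y, -, rfl⟩ := h l₀ hl₀
    refine ⟨y, fun l hl => ?_, rfl⟩
    obtain ⟨z, hz, hzy⟩ := h l hl
    rwa [← mul_left_cancel hzy]

variable (S) in
/-- `J(S) ∪ {∅}`. -/
def J₀ : Type _ := {X : Set S // IsConstructible X ∨ X = ∅}

namespace J₀

/-- The right ideal `S`. -/
def univ : J₀ S := ⟨Set.univ, Or.inl isConstructible_univ⟩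

/-- The empty set. -/
def empty : J₀ S := ⟨∅, Or.inr rfl⟩

/-- `X ∩ Y`. -/
def inter (X Y : J₀ S) : J₀ S := ⟨X.1 ∩ Y.1, by
  rcases X.2 with hX | hX
  · rcases Y.2 with hY | hY
    · exact Or.inl (hX.inter hY)
    · exact Or.inr (by rw [hY, Set.inter_empty])
  · exact Or.inr (by rw [hX, Set.empty_inter])⟩

/-- `sX`. -/
def image [IsLeftCancelMul S] (s : S) (X : J₀ S) : J₀ S := ⟨(fun y => s * y) '' X.1, by
  rcases X.2 with hX | hX
  · exact Or.inl (hX.image s)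
  · exact Or.inr (by rw [hX, Set.image_empty])⟩

end J₀

variable (S) in
/-- Clifford's condition. -/
def CliffordCondition : Prop :=
  ∀ s t : S, (Set.range fun x => s * x) ∩ (Set.range fun x => t * x) = ∅ ∨
    ∃ r : S, (Set.range fun x => s * x) ∩ (Set.range fun x => t * x) = Set.range fun x => r * x

end ConstructibleIdeals

/-- The free monoid with involution on `G`: words in the letters `g = (g, false)` and
`g* = (g, true)`. -/
def StarWord (G : Type*) : Type _ := FreeMonoid (G × Bool)

namespace StarWord

variable {G : Type*}

instance : Monoid (StarWord G) := inferInstanceAs (Monoid (FreeMonoid (G × Bool)))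

/-- The involution reverses a word and exchanges `g` and `g*`. -/
instance : StarMul (StarWord G) where
  star w := FreeMonoid.ofList ((FreeMonoid.toList w).map fun x => (x.1, !x.2)).reverse
  star_involutive w := by
    have h : ∀ l : List (G × Bool),
        (((l.map fun x => (x.1, !x.2)).reverse).map fun x => (x.1, !x.2)).reverse = l := by
      intro l
      induction l with
      | nil => rfl
      | cons a l ih => simp_all
    exact h (FreeMonoid.toList w)
  star_mul v w := by
    have h : ∀ l m : List (G × Bool), ((l ++ m).map fun x => (x.1, !x.2)).reverse =
        (m.map fun x => (x.1, !x.2)).reverse ++ (l.map fun x => (x.1, !x.2)).reverse := by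
      intro l m
      rw [List.map_append, List.reverse_append]
    exact h (FreeMonoid.toList v) (FreeMonoid.toList w)

/-- The letter `g`. -/
def letter (g : G) : StarWord G := FreeMonoid.of (g, false)

theorem star_letter (g : G) : star (letter g) = FreeMonoid.of (g, true) := rfl

theorem induction {motive : StarWord G → Prop} (w : StarWord G) (one : motive 1)
    (mul : ∀ g w, motive w → motive (letter g * w))
    (star_mul : ∀ g w, motive w → motive (star (letter g) * w)) : motive w := by
  have key : ∀ l : List (G × Bool), motive (FreeMonoid.ofList l) := by
    intro l
    induction l with
    | nil => exact one
    | cons a l ih =>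
      rcases a with ⟨g, b⟩
      cases b
      · exact mul g _ ih
      · exact star_mul g _ ih
  exact key w

end StarWord

section Li

/-- The generators of Li's C*-algebra: `v s` for `s ∈ S` and `e X` for `X ∈ J(S) ∪ {∅}`. -/
inductive LiGenerator (S : Type*) [Monoid S] : Type _
  | v (s : S) : LiGenerator S
  | e (X : J₀ S) : LiGenerator S

/-- The free unital *-algebra over `ℂ` on Li's generators. -/
abbrev LiFree (S : Type*) [Monoid S] : Type _ := MonoidAlgebra ℂ (StarWord (LiGenerator S))

/-- The generator `v_s`. -/
def LiFree.v {S : Type*} [Monoid S] (s : S) : LiFree S :=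
  MonoidAlgebra.of ℂ _ (StarWord.letter (LiGenerator.v s))

/-- The generator `e_X`. -/
def LiFree.e {S : Type*} [Monoid S] (X : J₀ S) : LiFree S :=
  MonoidAlgebra.of ℂ _ (StarWord.letter (LiGenerator.e X))

variable (S : Type*) [Monoid S] [IsLeftCancelMul S]

open LiFree in
/-- Li's relations: the `v_s` are isometries, the `e_X` are projections, and `v_{st} = v_s v_t`,
`v_s e_X v_s* = e_{sX}`, `e_S = 1`, `e_∅ = 0`, `e_{X ∩ Y} = e_X e_Y`. -/
inductive LiRel : LiFree S → LiFree S → Prop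
  | isometry (s : S) : LiRel (star (v s) * v s) 1
  | selfAdjoint (X : J₀ S) : LiRel (star (e X)) (e X)
  | idempotent (X : J₀ S) : LiRel (e X * e X) (e X)
  | mul (s t : S) : LiRel (v (s * t)) (v s * v t)
  | covariance (s : S) (X : J₀ S) : LiRel (v s * e X * star (v s)) (e (J₀.image s X))
  | univ : LiRel (e J₀.univ) 1
  | empty : LiRel (e J₀.empty) 0
  | inter (X Y : J₀ S) : LiRel (e (J₀.inter X Y)) (e X * e Y)

instance : HasUniversalCStar (LiRel S) := by
  apply hasUniversalCStar_of_le_one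
  intro p w
  have hletter : ∀ g : LiGenerator S,
      p.seminorm (MonoidAlgebra.of ℂ _ (StarWord.letter g)) ≤ 1 := by
    intro g
    cases g with
    | v s =>
      have h1 := p.star_mul_self (LiFree.v s)
      rw [p.congr (LiRel.isometry s)] at h1
      have h2 := p.one_le
      have h3 := apply_nonneg p.seminorm (LiFree.v s)
      change p.seminorm (LiFree.v s) ≤ 1
      nlinarith
    | e X =>
      have h1 := p.star_mul_self (LiFree.e X)
      have h2 : p.seminorm (star (LiFree.e X) * LiFree.e X) ≤ p.seminorm (LiFree.e X) := by
        have h3 : p.seminorm (star (LiFree.e X) * LiFree.e X - LiFree.e X * LiFree.e X) ≤ 0 := by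
          rw [← sub_mul]
          refine (p.mul_le _ _).trans ?_
          rw [p.rel (LiRel.selfAdjoint X), zero_mul]
        have h4 := abs_sub_map_le_sub p.seminorm (star (LiFree.e X) * LiFree.e X)
          (LiFree.e X * LiFree.e X)
        have h5 := le_abs_self (p.seminorm (star (LiFree.e X) * LiFree.e X) -
          p.seminorm (LiFree.e X * LiFree.e X))
        rw [← p.congr (LiRel.idempotent X)]
        linarith
      have h3 := apply_nonneg p.seminorm (LiFree.e X)
      change p.seminorm (LiFree.e X) ≤ 1
      by_contra hlt
      push Not at hlt
      nlinarith
  induction w using StarWord.induction with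
  | one => rw [map_one]; exact p.one_le
  | mul g w ih =>
    rw [map_mul]
    exact (p.mul_le _ _).trans (mul_le_one₀ (hletter g) (apply_nonneg _ _) ih)
  | star_mul g w ih =>
    rw [map_mul]
    refine (p.mul_le _ _).trans (mul_le_one₀ ?_ (apply_nonneg _ _) ih)
    have h : MonoidAlgebra.of ℂ _ (star (StarWord.letter g)) =
        star (MonoidAlgebra.of ℂ _ (StarWord.letter g)) := by
      simp [MonoidAlgebra.of_apply, star_single]
    rw [h, p.map_star]
    exact hletter g

/-- Li's full C*-algebra `C*(S)`: the universal unital C*-algebra generated by isometries `v_s`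
and projections `e_X` subject to Li's relations. -/
abbrev LiCStar : Type _ := UniversalCStar (LiRel S)

variable {S} in
/-- The generating isometry `v_s` of `C*(S)`. -/
def LiCStar.v (s : S) : LiCStar S := toUniversal (LiRel S) (LiFree.v s)

end Li

end SemigroupCStar

end

noncomputable section

namespace SemigroupCStar

/-! ### *-homomorphisms of C*-algebras with dense range -/

section DenseRange

variable {A B : Type*} [CStarAlgebra A] [CStarAlgebra B]

theorem exists_norm_le_of_isSelfAdjoint_map (φ : A →⋆ₐ[ℂ] B) (a : A)
    (ha : IsSelfAdjoint (φ a)) : ∃ a', φ a' = φ a ∧ ‖a'‖ ≤ ‖φ a‖ := by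
  have hφ : Continuous φ := AddMonoidHomClass.continuous_of_bound φ 1 fun a => by
    simpa using NonUnitalStarAlgHom.norm_apply_le φ a
  set h : A := (realPart a : A) with hh
  have hsa : IsSelfAdjoint h := (realPart a).2
  have hφh : φ h = φ a := by
    rw [hh, realPart_apply_coe, ← Complex.coe_smul, map_smul, map_add, map_star, ha.star_eq,
      Complex.coe_smul, ← two_smul ℝ, smul_smul]
    norm_num
  set c := ‖φ a‖
  have hc : 0 ≤ c := norm_nonneg _
  let f : ℝ → ℝ := fun x => max (-c) (min c x)
  have hf : Continuous f := by fun_prop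
  refine ⟨cfc f h, ?_, ?_⟩
  · rw [StarAlgHom.map_cfc φ f h hf.continuousOn hφ hsa (by rwa [hφh]), hφh]
    conv_rhs => rw [← cfc_id ℝ (φ a)]
    refine cfc_congr fun x hx => ?_
    have hx' : |x| ≤ c := by
      have : Nontrivial B := ⟨⟨φ a, φ a - 1, fun hne => by
        have h1 : (1 : B) = 0 := by simpa using (sub_eq_self.mp hne.symm)
        have := subsingleton_of_zero_eq_one h1.symm
        simp [Subsingleton.elim (φ a) 0] at hx⟩⟩
      exact spectrum.norm_le_norm_of_mem hx
    obtain ⟨h1, h2⟩ := abs_le.mp hx'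
    simp [f, h1, h2]
  · refine norm_cfc_le hc fun x _ => ?_
    rw [Real.norm_eq_abs, abs_le]
    exact ⟨le_max_left _ _, max_le (by linarith) (min_le_left _ _)⟩

theorem exists_norm_le_two_mul (φ : A →⋆ₐ[ℂ] B) (a : A) :
    ∃ a', φ a' = φ a ∧ ‖a'‖ ≤ 2 * ‖φ a‖ := by
  have hre : φ (realPart a : A) = realPart (φ a) := by
    rw [realPart_apply_coe, realPart_apply_coe, ← Complex.coe_smul, map_smul, map_add, map_star,
      Complex.coe_smul]
  have him : φ (imaginaryPart a : A) = imaginaryPart (φ a) := by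
    rw [imaginaryPart_apply_coe, imaginaryPart_apply_coe, map_smul, ← Complex.coe_smul, map_smul,
      map_sub, map_star, Complex.coe_smul]
  obtain ⟨x, hx, hxn⟩ := exists_norm_le_of_isSelfAdjoint_map φ (realPart a)
    (by rw [hre]; exact (realPart (φ a)).2)
  obtain ⟨y, hy, hyn⟩ := exists_norm_le_of_isSelfAdjoint_map φ (imaginaryPart a)
    (by rw [him]; exact (imaginaryPart (φ a)).2)
  rw [hre] at hxn
  rw [him] at hyn
  refine ⟨x + Complex.I • y, ?_, ?_⟩
  · rw [map_add, map_smul, hx, hy, hre, him, realPart_add_I_smul_imaginaryPart]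
  · have h1 : ‖(realPart (φ a) : B)‖ ≤ ‖φ a‖ := realPart.norm_le (φ a)
    have h2 : ‖(imaginaryPart (φ a) : B)‖ ≤ ‖φ a‖ := imaginaryPart.norm_le (φ a)
    calc ‖x + Complex.I • y‖ ≤ ‖x‖ + ‖Complex.I • y‖ := norm_add_le _ _
      _ = ‖x‖ + ‖y‖ := by rw [norm_smul, Complex.norm_I, one_mul]
      _ ≤ 2 * ‖φ a‖ := by linarith

/-- A *-homomorphism of C*-algebras with dense range is surjective. -/
theorem surjective_of_denseRange (φ : A →⋆ₐ[ℂ] B) (h : DenseRange φ) :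
    Function.Surjective φ := by
  let f : NormedAddGroupHom A B :=
    { toFun := φ
      map_add' := map_add φ
      bound' := ⟨1, fun a => by simpa using NonUnitalStarAlgHom.norm_apply_le φ a⟩ }
  have hyp : f.SurjectiveOnWith f.range 2 := by
    rintro _ ⟨a, rfl⟩
    exact exists_norm_le_two_mul φ a
  intro b
  obtain ⟨a, ha, -⟩ := controlled_closure_of_complete two_pos one_pos hyp b (h b)
  exact ⟨a, ha⟩

end DenseRange

/-! ### Universal properties -/

section Lift

variable {A B : Type*} [Ring A] [StarRing A] [Algebra ℂ A] [CStarAlgebra B]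

/-- The C*-seminorm `a ↦ ‖φ a‖` of a *-homomorphism `φ` that respects the relations `R`. -/
def Admissible.ofHom {R : A → A → Prop} (φ : A →⋆ₐ[ℂ] B) (h : ∀ a b, R a b → φ a = φ b) :
    Admissible R :=
  ⟨{ (normSeminorm ℂ B).comp φ.toAlgHom.toLinearMap with
      mul_le' := fun a b => by
        change ‖φ (a * b)‖ ≤ ‖φ a‖ * ‖φ b‖
        rw [map_mul]
        exact norm_mul_le _ _
      star_mul_self' := fun a => by
        change ‖φ (star a * a)‖ = ‖φ a‖ ^ 2
        rw [map_mul, StarHomClass.map_star, CStarRing.norm_star_mul_self, sq] },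
    fun a b hab => by
      change ‖φ (a - b)‖ = 0
      rw [map_sub, h a b hab, sub_self, norm_zero]⟩

variable (R : A → A → Prop) [HasUniversalCStar R]

theorem norm_map_le_maxNorm (φ : A →⋆ₐ[ℂ] B) (h : ∀ a b, R a b → φ a = φ b) (a : A) :
    ‖φ a‖ ≤ maxNorm R a :=
  le_maxNorm R (Admissible.ofHom φ h) a

theorem toUniversal_eq [StarModule ℂ A] {a b : A} (h : R a b) :
    toUniversal R a = toUniversal R b := by
  rw [← sub_eq_zero, ← map_sub, ← norm_eq_zero]
  refine (UniformSpace.Completion.norm_coe (E := PreUniversal R) (a - b)).trans ?_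
  change maxNorm (A := A) R (a - b) = 0
  exact le_antisymm (ciSup_le fun p : Admissible (A := A) R => (p.rel h).le)
    (maxNorm_nonneg R (a - b : A))

variable {R}

open UniformSpace in
theorem UniversalCStar.induction [StarModule ℂ A] {motive : UniversalCStar R → Prop}
    (x : UniversalCStar R) (hc : IsClosed {x | motive x}) (h : ∀ a, motive (toUniversal R a)) :
    motive x := by
  induction x using Completion.induction_on with
  | hp => exact hc
  | ih a => exact h a

variable (R) in
theorem continuous_preUniversal (φ : A →⋆ₐ[ℂ] B) (h : ∀ a b, R a b → φ a = φ b) :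
    Continuous (show PreUniversal R →+* B from (φ : A →+* B)) :=
  AddMonoidHomClass.continuous_of_bound
    (show PreUniversal R →+* B from (φ : A →+* B)) 1 fun a => by
      rw [one_mul]
      exact norm_map_le_maxNorm R φ h a

variable [StarModule ℂ A]

/-- The universal property of the universal C*-algebra. -/
def universalCStarLift (φ : A →⋆ₐ[ℂ] B) (h : ∀ a b, R a b → φ a = φ b) :
    UniversalCStar R →⋆ₐ[ℂ] B :=
  let g := UniformSpace.Completion.extensionHom _ (continuous_preUniversal R φ h)
  have hg : Continuous g := UniformSpace.Completion.continuous_extension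
  have hgc : ∀ a : A, g (toUniversal R a) = φ a := fun a =>
    UniformSpace.Completion.extensionHom_coe _ (continuous_preUniversal R φ h) a
  { g with
    commutes' := fun c => by
      refine (hgc (algebraMap ℂ A c)).trans ?_
      exact AlgHomClass.commutes φ c
    map_star' := fun x => by
      change g (star x) = star (g x)
      induction x using UniversalCStar.induction with
      | hc => exact isClosed_eq (hg.comp continuous_star) (continuous_star.comp hg)
      | h a => rw [← map_star, hgc, hgc, map_star] }

@[simp]
theorem universalCStarLift_toUniversal (φ : A →⋆ₐ[ℂ] B) (h : ∀ a b, R a b → φ a = φ b) (a : A) :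
    universalCStarLift φ h (toUniversal R a) = φ a :=
  UniformSpace.Completion.extensionHom_coe _ (continuous_preUniversal R φ h) a

end Lift

section MonoidLift

variable {M B : Type*} [Monoid M] [StarMul M] [CStarAlgebra B]

/-- The *-homomorphism on `ℂM` induced by a *-preserving homomorphism on `M`. -/
def monoidStarLift (f : M →* B) (hf : ∀ m, f (star m) = star (f m)) :
    MonoidAlgebra ℂ M →⋆ₐ[ℂ] B where
  __ := MonoidAlgebra.lift ℂ B M f
  map_star' x := by
    change MonoidAlgebra.lift ℂ B M f (star x) = star (MonoidAlgebra.lift ℂ B M f x)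
    induction x using MonoidAlgebra.induction_linear with
    | zero => simp
    | add x y hx hy => rw [star_add, map_add, map_add, hx, hy, star_add]
    | single m c =>
      rw [star_single, MonoidAlgebra.lift_single, MonoidAlgebra.lift_single, star_smul, hf]

theorem monoidStarLift_of (f : M →* B) (hf : ∀ m, f (star m) = star (f m)) (m : M) :
    monoidStarLift f hf (MonoidAlgebra.of ℂ M m) = f m :=
  MonoidAlgebra.lift_of f m

end MonoidLift

namespace StarWord

variable {G B : Type*} [Monoid B] [StarMul B]

/-- The universal property of the free monoid with involution. -/
def lift (f : G → B) : StarWord G →* B :=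
  FreeMonoid.lift fun x : G × Bool => if x.2 then star (f x.1) else f x.1

theorem lift_letter (f : G → B) (g : G) : lift f (letter g) = f g :=
  FreeMonoid.lift_eval_of _ _

theorem lift_star_letter (f : G → B) (g : G) : lift f (star (letter g)) = star (f g) :=
  FreeMonoid.lift_eval_of _ _

theorem lift_star (f : G → B) (w : StarWord G) : lift f (star w) = star (lift f w) := by
  induction w using StarWord.induction with
  | one => simp
  | mul g w ih => rw [star_mul, map_mul, map_mul, ih, lift_letter, lift_star_letter, star_mul]
  | star_mul g w ih =>
    rw [star_mul, map_mul, map_mul, ih, star_star, lift_letter, lift_star_letter, star_mul,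
      star_star]

end StarWord

section InverseSemigroupLift

variable {P B : Type*} [MonoidWithZero P] [StarMul P] [IsInverseSemigroup P] [CStarAlgebra B]

/-- A *-representation of `P` that kills `0` extends to `C*₀(P)`. -/
def FullCStarZero.lift (f : P →* B) (hf : ∀ p, f (star p) = star (f p)) (h0 : f 0 = 0) :
    FullCStarZero P →⋆ₐ[ℂ] B :=
  let F : FullCStar P →⋆ₐ[ℂ] B :=
    universalCStarLift (monoidStarLift f hf) fun _ _ h => h.elim
  have hF : ∀ x ∈ zeroIdeal P, F x = 0 := fun x hx => by
    obtain ⟨c, rfl⟩ := mem_zeroIdeal.mp hx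
    rw [map_smul, FullCStar.of, universalCStarLift_toUniversal, monoidStarLift_of, h0, smul_zero]
  { (Ideal.Quotient.liftₐ (zeroIdeal P) F.toAlgHom hF : FullCStarZero P →ₐ[ℂ] B) with
    map_star' := fun x => by
      obtain ⟨a, rfl⟩ := FullCStarZero.mk_surjective x
      exact map_star F a }

theorem FullCStarZero.lift_of (f : P →* B) (hf : ∀ p, f (star p) = star (f p)) (h0 : f 0 = 0)
    (p : P) : FullCStarZero.lift f hf h0 (FullCStarZero.of p) = f p :=
  (universalCStarLift_toUniversal (monoidStarLift f hf) (fun _ _ h => h.elim) _).trans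
    (monoidStarLift_of f hf p)

namespace FullCStarZero

theorem of_mul (p q : P) : of (p * q) = of p * of q := by
  rw [of, FullCStar.of_mul, map_mul]; rfl

theorem of_one : of (1 : P) = 1 := by
  rw [of, FullCStar.of, map_one, map_one, map_one]

theorem of_zero : of (0 : P) = 0 := by
  rw [of, ← map_zero mk, mk_eq_mk, sub_zero]
  exact mem_zeroIdeal.mpr ⟨1, one_smul _ _⟩

theorem star_of (p : P) : star (of p) = of (star p) := by
  rw [of, star_mk, FullCStar.star_of]; rfl

theorem continuous_mk : Continuous (mk : FullCStar P → FullCStarZero P) :=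
  AddMonoidHomClass.continuous_of_bound mk 1 fun a => by simpa using norm_mk_le a

/-- A *-homomorphism into `C*₀(P)` whose range contains `P` is surjective. -/
theorem surjective_of_forall_of_mem (φ : B →⋆ₐ[ℂ] FullCStarZero P)
    (h : ∀ p : P, of p ∈ Set.range φ) : Function.Surjective φ := by
  apply surjective_of_denseRange
  intro x
  obtain ⟨a, rfl⟩ := mk_surjective x
  induction a using FullCStar.induction with
  | hc => exact isClosed_closure.preimage continuous_mk
  | h0 => rw [map_zero]; exact subset_closure ⟨0, map_zero φ⟩
  | hadd a b ha hb =>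
    rw [map_add]
    exact (φ.range.topologicalClosure).add_mem ha hb
  | hof c p =>
    rw [map_smul]
    obtain ⟨b, hb⟩ := h p
    exact subset_closure ⟨c • b, by rw [map_smul, hb]; rfl⟩

end FullCStarZero

end InverseSemigroupLift

/-! ### The *-homomorphism onto `C*₀(I_l(S))` -/

namespace PartialBij

variable {X : Type*}

open Classical in
/-- The identity function of a subset. -/
def idOn (A : Set X) : PartialBij X := PEquiv.ofSet A

theorem maps_idOn {A : Set X} {x y : X} : Maps (idOn A) x y ↔ x ∈ A ∧ x = y := by
  classical
  refine (PEquiv.mem_ofSet_iff (s := A) (a := y) (b := x)).trans ?_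
  exact ⟨fun h => ⟨h.1 ▸ h.2, h.1.symm⟩, fun h => ⟨h.2.symm, h.2 ▸ h.1⟩⟩

theorem maps_one {x y : X} : Maps (1 : PartialBij X) x y ↔ x = y :=
  Option.some_inj

theorem not_maps_zero {x y : X} : ¬ Maps (0 : PartialBij X) x y := nofun

theorem idOn_univ : idOn (Set.univ : Set X) = 1 :=
  ext_maps fun x y => by simp [maps_idOn, maps_one]

theorem idOn_empty : idOn (∅ : Set X) = 0 :=
  ext_maps fun x y => by simp [maps_idOn, not_maps_zero]

theorem idOn_inter (A B : Set X) : idOn (A ∩ B) = idOn A * idOn B :=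
  ext_maps fun x y => by
    simp only [maps_mul, maps_idOn, Set.mem_inter_iff]
    constructor
    · rintro ⟨⟨hA, hB⟩, rfl⟩
      exact ⟨x, ⟨hB, rfl⟩, hA, rfl⟩
    · rintro ⟨_, ⟨hB, rfl⟩, hA, rfl⟩
      exact ⟨⟨hA, hB⟩, rfl⟩

theorem star_idOn (A : Set X) : star (idOn A) = idOn A :=
  ext_maps fun x y => by
    simp only [maps_star, maps_idOn]
    constructor <;> (rintro ⟨h, rfl⟩; exact ⟨h, rfl⟩)

theorem ne_zero_of_maps {f : PartialBij X} {x y : X} (h : Maps f x y) : f ≠ 0 :=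
  fun h0 => not_maps_zero (h0 ▸ h)

end PartialBij

open PartialBij

variable {S : Type*} [Monoid S] [IsLeftCancelMul S]

theorem maps_lam {s x y : S} : Maps (lam s) x y ↔ s * x = y :=
  Option.some_inj

theorem lam_mul (s t : S) : lam (s * t) = lam s * lam t :=
  ext_maps fun x y => by simp [maps_mul, maps_lam, mul_assoc]

theorem star_lam_mul_lam_self (s : S) : star (lam s) * lam s = 1 :=
  ext_maps fun x y => by simp [maps_mul, maps_lam, maps_star, maps_one, eq_comm]

theorem lam_mul_idOn_mul_star_lam (s : S) (A : Set S) :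
    lam s * idOn A * star (lam s) = idOn ((fun y => s * y) '' A) :=
  ext_maps fun x y => by
    simp only [maps_mul, maps_lam, maps_star, maps_idOn, Set.mem_image]
    constructor
    · rintro ⟨a, rfl, _, ⟨ha, rfl⟩, rfl⟩
      exact ⟨⟨a, ha, rfl⟩, rfl⟩
    · rintro ⟨⟨a, ha, rfl⟩, rfl⟩
      exact ⟨a, rfl, a, ⟨ha, rfl⟩, rfl⟩

theorem star_lam_mul_idOn_mul_lam (t : S) (A : Set S) :
    star (lam t) * idOn A * lam t = idOn {x | t * x ∈ A} :=
  ext_maps fun x y => by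
    simp [maps_mul, maps_lam, maps_star, maps_idOn]

theorem lam_mem (s : S) : lam s ∈ leftInverseHull S :=
  Submonoid.subset_closure (Or.inl ⟨s, rfl⟩)

theorem star_lam_mem (s : S) : star (lam s) ∈ leftInverseHull S :=
  Submonoid.subset_closure (Or.inr ⟨s, rfl⟩)

theorem lam_mem₀ (s : S) : lam s ∈ leftInverseHull₀ S :=
  Or.inl (lam_mem s)

theorem idOn_wordIdeal_mem (l : List (S × S)) : idOn (wordIdeal l) ∈ leftInverseHull S := by
  induction l with
  | nil => rw [wordIdeal, idOn_univ]; exact one_mem _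
  | cons p l ih =>
    obtain ⟨t, s⟩ := p
    rw [wordIdeal, ← star_lam_mul_idOn_mul_lam, ← lam_mul_idOn_mul_star_lam]
    exact mul_mem (mul_mem (star_lam_mem t)
      (mul_mem (mul_mem (lam_mem s) ih) (star_lam_mem s))) (lam_mem t)

theorem IsConstructible.idOn_mem {A : Set S} (hA : IsConstructible A) :
    idOn A ∈ leftInverseHull S := by
  classical
  obtain ⟨F, -, -, rfl⟩ := hA
  induction F using Finset.induction_on with
  | empty => simp [idOn_univ]
  | insert l F _ ih =>
    rw [Finset.set_biInter_insert, idOn_inter]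
    exact mul_mem (idOn_wordIdeal_mem l) ih

theorem J₀.idOn_mem (X : J₀ S) : idOn X.1 ∈ leftInverseHull₀ S := by
  rcases X.2 with h | h
  · exact Or.inl h.idOn_mem
  · right
    rw [h, idOn_empty]
    rfl

/-- The images in `C*₀(I_l(S))` of Li's generators. -/
def LiGenerator.toHull : LiGenerator S → HullCStar S
  | .v s => HullCStar.lam s
  | .e X => FullCStarZero.of ⟨idOn X.1, X.idOn_mem⟩

theorem FullCStarZero.of_mk_mul {f g : PartialBij S} (hf : f ∈ leftInverseHull₀ S)
    (hg : g ∈ leftInverseHull₀ S) :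
    (FullCStarZero.of ⟨f, hf⟩ * FullCStarZero.of ⟨g, hg⟩ : HullCStar S) =
      FullCStarZero.of ⟨f * g, mul_mem hf hg⟩ :=
  (FullCStarZero.of_mul _ _).symm

theorem FullCStarZero.star_of_mk {f : PartialBij S} (hf : f ∈ leftInverseHull₀ S) :
    star (FullCStarZero.of ⟨f, hf⟩ : HullCStar S) =
      FullCStarZero.of ⟨star f, star_mem_leftInverseHull₀ S hf⟩ :=
  FullCStarZero.star_of _

theorem HullCStar.lam_eq (s : S) :
    HullCStar.lam s = FullCStarZero.of ⟨SemigroupCStar.lam s, lam_mem₀ s⟩ :=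
  rfl

variable (S) in
/-- The *-homomorphism from the free *-algebra on Li's generators to `C*₀(I_l(S))`. -/
def LiFree.toHull : LiFree S →⋆ₐ[ℂ] HullCStar S :=
  monoidStarLift (StarWord.lift LiGenerator.toHull) (StarWord.lift_star _)

theorem LiFree.toHull_v (s : S) : LiFree.toHull S (LiFree.v s) = HullCStar.lam s :=
  (monoidStarLift_of _ _ _).trans (StarWord.lift_letter _ _)

theorem LiFree.toHull_e (X : J₀ S) :
    LiFree.toHull S (LiFree.e X) = FullCStarZero.of ⟨idOn X.1, X.idOn_mem⟩ :=
  (monoidStarLift_of _ _ _).trans (StarWord.lift_letter _ _)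

theorem LiFree.toHull_rel {a b : LiFree S} (h : LiRel S a b) :
    LiFree.toHull S a = LiFree.toHull S b := by
  cases h with
  | isometry s =>
    rw [map_mul, map_star, map_one, toHull_v, HullCStar.lam_eq, FullCStarZero.star_of_mk,
      FullCStarZero.of_mk_mul, ← FullCStarZero.of_one]
    exact congrArg _ (Subtype.ext (star_lam_mul_lam_self s))
  | selfAdjoint X =>
    rw [map_star, toHull_e, FullCStarZero.star_of_mk]
    exact congrArg _ (Subtype.ext (star_idOn _))
  | idempotent X =>
    rw [map_mul, toHull_e, FullCStarZero.of_mk_mul]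
    exact congrArg _ (Subtype.ext ((idOn_inter _ _).symm.trans (congrArg idOn (Set.inter_self _))))
  | mul s t =>
    rw [map_mul, toHull_v, toHull_v, toHull_v, HullCStar.lam_eq, HullCStar.lam_eq, HullCStar.lam_eq,
      FullCStarZero.of_mk_mul]
    exact congrArg _ (Subtype.ext (lam_mul s t))
  | covariance s X =>
    rw [map_mul, map_mul, map_star, toHull_v, toHull_e, toHull_e, HullCStar.lam_eq,
      FullCStarZero.star_of_mk, FullCStarZero.of_mk_mul, FullCStarZero.of_mk_mul]
    exact congrArg _ (Subtype.ext (lam_mul_idOn_mul_star_lam s X.1))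
  | univ =>
    rw [map_one, toHull_e, ← FullCStarZero.of_one]
    exact congrArg _ (Subtype.ext idOn_univ)
  | empty =>
    rw [map_zero, toHull_e, ← FullCStarZero.of_zero]
    exact congrArg _ (Subtype.ext idOn_empty)
  | inter X Y =>
    rw [map_mul, toHull_e, toHull_e, toHull_e, FullCStarZero.of_mk_mul]
    exact congrArg _ (Subtype.ext (idOn_inter _ _))

variable (S) in
/-- The canonical *-homomorphism `C*(S) → C*₀(I_l(S))`. -/
def LiCStar.toHull : LiCStar S →⋆ₐ[ℂ] HullCStar S :=
  universalCStarLift (LiFree.toHull S) fun _ _ h => LiFree.toHull_rel h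

theorem LiCStar.toHull_v (s : S) : LiCStar.toHull S (LiCStar.v s) = HullCStar.lam s :=
  (universalCStarLift_toUniversal _ _ _).trans (LiFree.toHull_v s)

/-- The generating projection `e_X` of `C*(S)`. -/
def LiCStar.e (X : J₀ S) : LiCStar S := toUniversal (LiRel S) (LiFree.e X)

theorem LiCStar.toHull_e (X : J₀ S) :
    LiCStar.toHull S (LiCStar.e X) = FullCStarZero.of ⟨idOn X.1, X.idOn_mem⟩ :=
  (universalCStarLift_toUniversal _ _ _).trans (LiFree.toHull_e X)

theorem LiCStar.toHull_surjective : Function.Surjective (LiCStar.toHull S) := by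
  apply FullCStarZero.surjective_of_forall_of_mem
  rintro ⟨f, hf | hf⟩
  · induction hf using Submonoid.closure_induction with
    | mem f hf =>
      rcases hf with ⟨s, rfl⟩ | ⟨s, rfl⟩
      · exact ⟨LiCStar.v s, LiCStar.toHull_v s⟩
      · refine ⟨star (LiCStar.v s), ?_⟩
        rw [map_star, LiCStar.toHull_v]
        exact FullCStarZero.star_of_mk (lam_mem₀ s)
    | one => exact ⟨1, (map_one _).trans FullCStarZero.of_one.symm⟩
    | mul f g hf hg ihf ihg =>
      obtain ⟨a, ha⟩ := ihf
      obtain ⟨b, hb⟩ := ihg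
      exact ⟨a * b, by
        rw [map_mul, ha, hb]
        exact FullCStarZero.of_mk_mul (Or.inl hf) (Or.inl hg)⟩
  · rw [Set.mem_singleton_iff] at hf
    subst hf
    exact ⟨0, (map_zero _).trans FullCStarZero.of_zero.symm⟩

/-! ### The inverse under Clifford's condition -/

namespace LiCStar

theorem star_v_mul_v_self (s : S) : star (v s) * v s = 1 := by
  rw [v, ← map_star, ← map_mul, toUniversal_eq _ (LiRel.isometry s), map_one]

theorem v_mul (s t : S) : v (s * t) = v s * v t := by
  rw [v, toUniversal_eq _ (LiRel.mul s t), map_mul]; rfl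

theorem v_one : v (1 : S) = 1 := by
  have h := star_v_mul_v_self (1 : S)
  calc v (1 : S) = star (v 1) * v 1 * v 1 := by rw [h, one_mul]
    _ = 1 := by rw [mul_assoc, ← v_mul, one_mul, h]

theorem e_empty : e (J₀.empty : J₀ S) = 0 := by
  rw [e, toUniversal_eq _ LiRel.empty, map_zero]

theorem e_inter (X Y : J₀ S) : e (J₀.inter X Y) = e X * e Y := by
  rw [e, toUniversal_eq _ (LiRel.inter X Y), map_mul]; rfl

theorem v_mul_star_v (s : S) : v s * star (v s) = e (J₀.image s J₀.univ) := by
  have h := toUniversal_eq _ (LiRel.covariance s (J₀.univ : J₀ S))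
  rw [map_mul, map_mul, toUniversal_eq _ LiRel.univ, map_one, mul_one, map_star] at h
  exact h

/-- A *-homomorphism out of `C*(S)` fixing the generators is the identity. -/
theorem eq_id_of_forall (φ : LiCStar S →⋆ₐ[ℂ] LiCStar S) (hv : ∀ s, φ (v s) = v s)
    (he : ∀ X, φ (e X) = e X) (x : LiCStar S) : φ x = x := by
  have hφ : Continuous φ := AddMonoidHomClass.continuous_of_bound φ 1 fun a => by
    simpa using NonUnitalStarAlgHom.norm_apply_le φ a
  have hg : ∀ g : LiGenerator S, φ (toUniversal (LiRel S) (MonoidAlgebra.of ℂ _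
      (StarWord.letter g))) = toUniversal (LiRel S) (MonoidAlgebra.of ℂ _ (StarWord.letter g)) := by
    rintro (s | X)
    exacts [hv s, he X]
  induction x using UniversalCStar.induction with
  | hc => exact isClosed_eq hφ continuous_id
  | h a =>
    induction a using MonoidAlgebra.induction_on with
    | of w =>
      induction w using StarWord.induction with
      | one => rw [map_one, map_one, map_one]
      | mul g w ih => rw [map_mul, map_mul, map_mul, ih, hg]
      | star_mul g w ih =>
        have h : MonoidAlgebra.of ℂ _ (star (StarWord.letter g)) =
            star (MonoidAlgebra.of ℂ _ (StarWord.letter g)) := by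
          simp [MonoidAlgebra.of_apply, star_single]
        rw [map_mul, map_mul, map_mul, ih, h, map_star, map_star, hg]
    | add x y hx hy => rw [map_add, map_add, hx, hy]
    | smul c x hx => rw [map_smul, map_smul, hx]

end LiCStar

theorem maps_lam_mul_star_lam {s t x y : S} :
    Maps (lam s * star (lam t)) x y ↔ ∃ z, t * z = x ∧ s * z = y := by
  simp only [maps_mul, maps_star, maps_lam]

theorem lam_mul_star_lam_ne_zero (s t : S) : lam s * star (lam t) ≠ 0 :=
  ne_zero_of_maps (maps_lam_mul_star_lam.mpr ⟨1, rfl, rfl⟩)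

/-- If `λ_s λ_t* = λ_p λ_q*`, then `(p, q) = (s u, t u)` for an invertible `u`. -/
theorem exists_unit_of_lam_mul_star_lam_eq {s t p q : S}
    (h : lam s * star (lam t) = lam p * star (lam q)) :
    ∃ u w : S, u * w = 1 ∧ p = s * u ∧ q = t * u := by
  have h1 : Maps (lam p * star (lam q)) t s := h ▸ maps_lam_mul_star_lam.mpr ⟨1, by simp⟩
  have h2 : Maps (lam s * star (lam t)) q p := h ▸ maps_lam_mul_star_lam.mpr ⟨1, by simp⟩
  obtain ⟨w, hqw, -⟩ := maps_lam_mul_star_lam.mp h1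
  obtain ⟨u, htu, hsu⟩ := maps_lam_mul_star_lam.mp h2
  refine ⟨u, w, ?_, hsu.symm, htu.symm⟩
  apply mul_left_cancel (a := t)
  rw [← mul_assoc, htu, hqw, mul_one]

namespace LiCStar

theorem v_mul_star_v_of_mul_eq_one {u w : S} (h : u * w = 1) : v u * star (v u) = 1 := by
  have hw : v u * v w = 1 := by rw [← v_mul, h, v_one]
  have : star (v u) = v w := by
    rw [← mul_one (star (v u)), ← hw, ← mul_assoc, star_v_mul_v_self, one_mul]
  rw [this, hw]

theorem v_mul_star_v_congr {s t p q : S} (h : lam s * star (lam t) = lam p * star (lam q)) :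
    v s * star (v t) = v p * star (v q) := by
  obtain ⟨u, w, hu, rfl, rfl⟩ := exists_unit_of_lam_mul_star_lam_eq h
  rw [v_mul, v_mul, star_mul, mul_assoc, ← mul_assoc (v u), v_mul_star_v_of_mul_eq_one hu, one_mul]

open Classical in
/-- The map `λ_s λ_t* ↦ v_s v_t*`, `0 ↦ 0`. -/
def ofHullFun (f : PartialBij S) : LiCStar S :=
  if h : ∃ p : S × S, f = lam p.1 * star (lam p.2) then v h.choose.1 * star (v h.choose.2) else 0

theorem ofHullFun_lam (s t : S) : ofHullFun (lam s * star (lam t)) = v s * star (v t) := by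
  have h : ∃ p : S × S, lam s * star (lam t) = lam p.1 * star (lam p.2) := ⟨(s, t), rfl⟩
  rw [ofHullFun, dif_pos h]
  exact (v_mul_star_v_congr h.choose_spec).symm

theorem ofHullFun_zero : ofHullFun (0 : PartialBij S) = 0 :=
  dif_neg fun ⟨p, hp⟩ => lam_mul_star_lam_ne_zero p.1 p.2 hp.symm

theorem star_v_mul_v_of_inter_eq_empty {s t : S}
    (h : (Set.range fun x => s * x) ∩ (Set.range fun x => t * x) = ∅) :
    star (v s) * v t = 0 := by
  have he : v s * star (v s) * (v t * star (v t)) = 0 := by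
    rw [v_mul_star_v, v_mul_star_v, ← e_inter, ← e_empty]
    congr 1
    apply Subtype.ext
    simpa [J₀.inter, J₀.image, J₀.univ, J₀.empty, Set.image_univ] using h
  calc star (v s) * v t
      = (star (v s) * v s) * (star (v s) * v t) * (star (v t) * v t) := by
        rw [star_v_mul_v_self, star_v_mul_v_self, one_mul, mul_one]
    _ = star (v s) * (v s * star (v s) * (v t * star (v t))) * v t := by simp only [mul_assoc]
    _ = 0 := by rw [he, mul_zero, zero_mul]

theorem star_v_mul_v_of_inter_eq {s t a b : S} (hab : s * a = t * b)
    (h : (Set.range fun x => s * x) ∩ (Set.range fun x => t * x) =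
      Set.range fun x => s * a * x) :
    star (v s) * v t = v a * star (v b) := by
  have he : v s * star (v s) * (v t * star (v t)) = v (s * a) * star (v (s * a)) := by
    rw [v_mul_star_v, v_mul_star_v, v_mul_star_v, ← e_inter]
    congr 1
    apply Subtype.ext
    simpa [J₀.inter, J₀.image, J₀.univ, Set.image_univ] using h
  calc star (v s) * v t
      = (star (v s) * v s) * (star (v s) * v t) * (star (v t) * v t) := by
        rw [star_v_mul_v_self, star_v_mul_v_self, one_mul, mul_one]
    _ = star (v s) * (v s * star (v s) * (v t * star (v t))) * v t := by simp only [mul_assoc]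
    _ = star (v s) * (v (s * a) * star (v (t * b))) * v t := by rw [he, ← hab]
    _ = (star (v s) * v s) * v a * star (v b) * (star (v t) * v t) := by
        simp only [v_mul, star_mul, mul_assoc]
    _ = v a * star (v b) := by rw [star_v_mul_v_self, star_v_mul_v_self, one_mul, mul_one]

end LiCStar

theorem star_lam_mul_lam_of_inter_eq_empty {s t : S}
    (h : (Set.range fun x => s * x) ∩ (Set.range fun x => t * x) = ∅) :
    star (lam s) * lam t = 0 := by
  apply ext_maps
  intro x y
  simp only [maps_mul, maps_star, maps_lam, not_maps_zero, iff_false]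
  rintro ⟨z, hz, hz'⟩
  exact Set.notMem_empty z (h ▸ ⟨⟨y, hz'⟩, ⟨x, hz⟩⟩)

theorem star_lam_mul_lam_of_inter_eq {s t a b : S} (hab : s * a = t * b)
    (h : (Set.range fun x => s * x) ∩ (Set.range fun x => t * x) =
      Set.range fun x => s * a * x) :
    star (lam s) * lam t = lam a * star (lam b) := by
  apply ext_maps
  intro x y
  simp only [maps_mul, maps_star, maps_lam]
  constructor
  · rintro ⟨z, hz, hz'⟩
    have : z ∈ Set.range fun x => s * a * x := h ▸ ⟨⟨y, hz'⟩, ⟨x, hz⟩⟩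
    obtain ⟨c, rfl⟩ := this
    refine ⟨c, mul_left_cancel (a := t) ?_, mul_left_cancel (a := s) ?_⟩
    · rw [hz, ← mul_assoc, hab]
    · rw [hz', ← mul_assoc]
  · rintro ⟨c, rfl, rfl⟩
    exact ⟨s * (a * c), by rw [← mul_assoc, ← mul_assoc, hab], rfl⟩

/-- Under Clifford's condition, the products `λ_s* λ_t` and `v_s* v_t` have the same normal form. -/
theorem CliffordCondition.cases (hS : CliffordCondition S) (s t : S) :
    (star (lam s) * lam t = 0 ∧ star (LiCStar.v s) * LiCStar.v t = 0) ∨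
      ∃ a b : S, star (lam s) * lam t = lam a * star (lam b) ∧
        star (LiCStar.v s) * LiCStar.v t = LiCStar.v a * star (LiCStar.v b) := by
  rcases hS s t with h | ⟨r, h⟩
  · exact Or.inl ⟨star_lam_mul_lam_of_inter_eq_empty h, LiCStar.star_v_mul_v_of_inter_eq_empty h⟩
  · have hr : r ∈ (Set.range fun x => s * x) ∩ (Set.range fun x => t * x) :=
      h ▸ ⟨1, mul_one r⟩
    obtain ⟨⟨a, rfl⟩, ⟨b, hb⟩⟩ := hr
    exact Or.inr ⟨a, b, star_lam_mul_lam_of_inter_eq hb.symm h,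
      LiCStar.star_v_mul_v_of_inter_eq hb.symm h⟩

theorem CliffordCondition.mul_eq (hS : CliffordCondition S) (s t p q : S) :
    (lam s * star (lam t) * (lam p * star (lam q)) = 0 ∧
      LiCStar.v s * star (LiCStar.v t) * (LiCStar.v p * star (LiCStar.v q)) = 0) ∨
    ∃ a b : S, lam s * star (lam t) * (lam p * star (lam q)) = lam a * star (lam b) ∧
      LiCStar.v s * star (LiCStar.v t) * (LiCStar.v p * star (LiCStar.v q)) =
        LiCStar.v a * star (LiCStar.v b) := by
  have e1 : lam s * star (lam t) * (lam p * star (lam q)) =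
      lam s * (star (lam t) * lam p) * star (lam q) := by simp only [mul_assoc]
  have e2 : LiCStar.v s * star (LiCStar.v t) * (LiCStar.v p * star (LiCStar.v q)) =
      LiCStar.v s * (star (LiCStar.v t) * LiCStar.v p) * star (LiCStar.v q) := by
    simp only [mul_assoc]
  rw [e1, e2]
  rcases hS.cases t p with ⟨h1, h2⟩ | ⟨a, b, h1, h2⟩
  · left
    rw [h1, h2]
    simp
  · refine Or.inr ⟨s * a, q * b, ?_, ?_⟩
    · rw [h1, lam_mul, lam_mul, star_mul]
      simp only [mul_assoc]
    · rw [h2, LiCStar.v_mul, LiCStar.v_mul, star_mul]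
      simp only [mul_assoc]

theorem lam_one : lam (1 : S) = 1 :=
  ext_maps fun x y => by simp [maps_lam, maps_one]

theorem CliffordCondition.eq_zero_or_eq (hS : CliffordCondition S) {f : PartialBij S}
    (hf : f ∈ leftInverseHull₀ S) : f = 0 ∨ ∃ s t, f = lam s * star (lam t) := by
  rcases hf with hf | hf
  · induction hf using Submonoid.closure_induction with
    | mem f hf =>
      right
      rcases hf with ⟨s, rfl⟩ | ⟨s, rfl⟩
      · exact ⟨s, 1, by rw [lam_one, star_one, mul_one]⟩
      · exact ⟨1, s, by rw [lam_one, one_mul]⟩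
    | one => exact Or.inr ⟨1, 1, by rw [lam_one, star_one, mul_one]⟩
    | mul f g _ _ hf hg =>
      rcases hf with rfl | ⟨s, t, rfl⟩
      · exact Or.inl (zero_mul g)
      rcases hg with rfl | ⟨p, q, rfl⟩
      · exact Or.inl (mul_zero _)
      rcases hS.mul_eq s t p q with h | ⟨a, b, h, -⟩
      exacts [Or.inl h.1, Or.inr ⟨a, b, h⟩]
  · exact Or.inl hf

namespace LiCStar

theorem ofHullFun_one : ofHullFun (1 : PartialBij S) = 1 := by
  have h := ofHullFun_lam (1 : S) 1
  rwa [lam_one, star_one, mul_one, v_one, star_one, mul_one] at h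

theorem ofHullFun_mul (hS : CliffordCondition S) {f g : PartialBij S}
    (hf : f ∈ leftInverseHull₀ S) (hg : g ∈ leftInverseHull₀ S) :
    ofHullFun (f * g) = ofHullFun f * ofHullFun g := by
  rcases hS.eq_zero_or_eq hf with rfl | ⟨s, t, rfl⟩
  · rw [zero_mul, ofHullFun_zero, zero_mul]
  rcases hS.eq_zero_or_eq hg with rfl | ⟨p, q, rfl⟩
  · rw [mul_zero, ofHullFun_zero, mul_zero]
  rcases hS.mul_eq s t p q with ⟨h1, h2⟩ | ⟨a, b, h1, h2⟩
  · rw [h1, ofHullFun_lam, ofHullFun_lam, h2, ofHullFun_zero]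
  · rw [h1, ofHullFun_lam, ofHullFun_lam, ofHullFun_lam, h2]

theorem ofHullFun_star (hS : CliffordCondition S) {f : PartialBij S}
    (hf : f ∈ leftInverseHull₀ S) : ofHullFun (star f) = star (ofHullFun f) := by
  rcases hS.eq_zero_or_eq hf with rfl | ⟨s, t, rfl⟩
  · rw [PartialBij.star_zero, ofHullFun_zero, _root_.star_zero]
  · rw [star_mul, star_star, ofHullFun_lam, ofHullFun_lam, star_mul, star_star]

theorem ofHullFun_idOn (hS : CliffordCondition S) (X : J₀ S) : ofHullFun (idOn X.1) = e X := by
  rcases hS.eq_zero_or_eq X.idOn_mem with h | ⟨s, t, h⟩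
  · rw [h, ofHullFun_zero, ← e_empty]
    congr 1
    apply Subtype.ext
    refine (Set.eq_empty_of_forall_notMem fun x hx => ?_).symm
    exact ne_zero_of_maps (maps_idOn.mpr ⟨hx, rfl⟩) h
  · have hst : t = s := (maps_idOn.mp (h ▸ maps_lam_mul_star_lam.mpr ⟨1, by simp⟩)).2
    subst hst
    rw [h, ofHullFun_lam, v_mul_star_v]
    congr 1
    apply Subtype.ext
    ext x
    have hx : x ∈ X.1 ↔ Maps (idOn X.1) x x := by simp [maps_idOn]
    rw [hx, h, maps_lam_mul_star_lam]
    simp [J₀.image, J₀.univ]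

/-- The *-homomorphism `C*₀(I_l(S)) → C*(S)` with `λ_s ↦ v_s`, under Clifford's condition. -/
def ofHull (hS : CliffordCondition S) : HullCStar S →⋆ₐ[ℂ] LiCStar S :=
  FullCStarZero.lift
    { toFun := fun f : leftInverseHull₀ S => ofHullFun f.1
      map_one' := ofHullFun_one
      map_mul' := fun f g => ofHullFun_mul hS f.2 g.2 }
    (fun f => ofHullFun_star hS f.2) ofHullFun_zero

theorem ofHull_of (hS : CliffordCondition S) (f : leftInverseHull₀ S) :
    ofHull hS (FullCStarZero.of f) = ofHullFun f.1 :=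
  FullCStarZero.lift_of _ _ _ f

theorem ofHull_toHull (hS : CliffordCondition S) (x : LiCStar S) :
    ofHull hS (toHull S x) = x := by
  refine eq_id_of_forall ((ofHull hS).comp (toHull S)) (fun s => ?_) (fun X => ?_) x
  · rw [StarAlgHom.comp_apply, toHull_v, HullCStar.lam_eq, ofHull_of]
    have h := ofHullFun_lam s 1
    rwa [lam_one, star_one, mul_one, v_one, star_one, mul_one] at h
  · rw [StarAlgHom.comp_apply, toHull_e, ofHull_of]
    exact ofHullFun_idOn hS X

end LiCStar

end SemigroupCStar
end

theorem mainTheorem3 (S : Type*) [Monoid S] [IsLeftCancelMul S] :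
    ∃ η : SemigroupCStar.LiCStar S →⋆ₐ[ℂ] SemigroupCStar.HullCStar S,
      Function.Surjective η ∧
      (∀ s : S, η (SemigroupCStar.LiCStar.v s) = SemigroupCStar.HullCStar.lam s) ∧
      (SemigroupCStar.CliffordCondition S → Function.Bijective η) :=
  ⟨SemigroupCStar.LiCStar.toHull S, SemigroupCStar.LiCStar.toHull_surjective,
    SemigroupCStar.LiCStar.toHull_v, fun hS =>
      ⟨Function.LeftInverse.injective (SemigroupCStar.LiCStar.ofHull_toHull hS),
        SemigroupCStar.LiCStar.toHull_surjective⟩⟩
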